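/- Let $G$ be a countably infinite amenable group and let $(F_n)$ be a Følner sequence in $G$, i.e. a sequence of nonempty finite subsets with $|KF_n\,\triangle\,F_n|/|F_n|\to 0$ for every nonempty finite $K\subset G$. A $G$-subshift is a closed subset $X$ of $\mathcal A^G$ ($\mathcal A$ a finite discrete alphabet, product topology) that is invariant under the shift action $(\sigma^g x)(h)=x(hg)$, considered with this action. A factor map between $G$-subshifts is a continuous surjection commuting with the actions. The topological entropy of a $G$-subshift $X$ with action $T$ is $$h(X,T)=\sup_{\mathcal U}\ \lim_{n\to\infty}\frac1{|F_n|}\log N\Big(\bigvee_{g\in F_n}T^{g^{-1}}\mathcal U\Big),$$ where $\mathcal U$ runs over the finite open covers of $X$ and $N(\mathcal V)$ is the minimal cardinality of a subcover of $\mathcal V$; the limit exists and does not depend on $(F_n)$. Let $(X,T)$ and $(Y,S)$ be $G$-subshifts and let $\pi:X\to Y$ be a factor map. Let $\mathcal H^{\pi}_{sub}(X,Y)$ be the set of all $r\in\mathbb R$ for which there exist a $G$-subshift $(Z,R)$ with $h(Z,R)=r$ and factor maps $\varphi:X\to Z$ and $\psi:Z\to Y$ with $\pi=\psi\circ\varphi$.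 Then $h(Y,S)$ and $h(X,T)$ are finite, and $\mathcal H^{\pi}_{sub}(X,Y)$ is a dense subset of the interval $[h(Y,S),h(X,T)]$. -/

import Mathlib

open Filter Topology

noncomputable section

section Folner

open scoped Classical Pointwise symmDiff in
/-- A (left) Følner sequence in `G`: nonempty finite sets `F n` such that
`|K F n ∆ F n| / |F n| → 0` for every nonempty finite `K`. A countable group is amenable
if and only if it has such a sequence. -/
structure IsFolnerSeq {G : Type*} [Group G] (F : ℕ → Finset G) : Prop where
  nonempty : ∀ n, (F n).Nonempty
  tendsto : ∀ K : Finset G, K.Nonempty →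
    Tendsto (fun n => (((K * F n) ∆ F n).card : ℝ) / ((F n).card : ℝ)) atTop (𝓝 0)

end Folner

section Entropy

variable {G : Type*} [Group G] {X : Type*} [MulAction G X]

/-- The join `⋁_{g ∈ E} T^{g⁻¹} 𝒰`, consisting of the sets `⋂_{g ∈ E} (T^g)⁻¹ (U_g)` with
every `U_g` in `𝒰`. -/
def joinCover (𝒰 : Set (Set X)) (E : Finset G) : Set (Set X) :=
  {V | ∃ U : G → Set X, (∀ g ∈ E, U g ∈ 𝒰) ∧ V = ⋂ g ∈ E, (fun x : X => g • x) ⁻¹' (U g)}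

/-- The minimal cardinality of a subcover of the cover `𝒱` of `X`. -/
def coverNumber {X : Type*} (𝒱 : Set (Set X)) : ℕ :=
  sInf {n | ∃ S : Finset (Set X), (S : Set (Set X)) ⊆ 𝒱 ∧
    ⋃₀ (S : Set (Set X)) = Set.univ ∧ S.card = n}

/-- `h(T, 𝒰) = lim_n (1 / |F n|) log N(𝒰_{F n})`. For a Følner sequence `F` and a finite open
cover of a compact system the limit is known to exist and not to depend on `F`; it is written
as a `limsup`, so that the definition does not rest on that fact. -/
def coverEntropy (F : ℕ → Finset G) (𝒰 : Set (Set X)) : EReal :=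
  limsup (fun n => ((Real.log (coverNumber (joinCover 𝒰 (F n))) / ((F n).card : ℝ) : ℝ) : EReal))
    atTop

/-- Topological entropy: the supremum of `h(T, 𝒰)` over all finite open covers `𝒰` of `X`. -/
def topEntropy (F : ℕ → Finset G) (X : Type*) [TopologicalSpace X] [MulAction G X] : EReal :=
  ⨆ (𝒰 : Set (Set X)) (_ : 𝒰.Finite) (_ : ∀ U ∈ 𝒰, IsOpen U) (_ : ⋃₀ 𝒰 = Set.univ),
    coverEntropy F 𝒰

end Entropy

/-- A factor map between `G`-systems: a continuous equivariant surjection. -/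
structure IsFactorMap (G : Type*) [Group G] {X Y : Type*} [TopologicalSpace X] [MulAction G X]
    [TopologicalSpace Y] [MulAction G Y] (f : X → Y) : Prop where
  continuous : Continuous f
  surjective : Function.Surjective f
  map_smul : ∀ (g : G) (x : X), f (g • x) = g • f x

/-- The shift action on `A^G`: `(σ^g x)(h) = x(hg)`. -/
def shiftBy {G A : Type*} [Group G] (g : G) (x : G → A) : G → A := fun h => x (h * g)

/-- A `G`-subshift over the alphabet `A` (a finite discrete space in all uses): a closed
shift-invariant subset of `A^G` with the product topology. -/
structure GSubshift (G A : Type*) [Group G] [TopologicalSpace A] where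
  carrier : Set (G → A)
  isClosed : IsClosed carrier
  shift_mem : ∀ (g : G) (x : G → A), x ∈ carrier → shiftBy g x ∈ carrier

namespace GSubshift

variable {G A : Type*} [Group G] [TopologicalSpace A]

instance : CoeSort (GSubshift G A) (Type _) := ⟨fun X => X.carrier⟩

/-- The shift action restricted to a subshift. -/
instance (X : GSubshift G A) : MulAction G X where
  smul g x := ⟨shiftBy g x.1, X.shift_mem g x.1 x.2⟩
  one_smul x := Subtype.ext (funext fun h => congrArg x.1 (mul_one h))
  mul_smul g k x := Subtype.ext (funext fun h => congrArg x.1 (mul_assoc h g k).symm)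

end GSubshift

/-- The set of real numbers `r` for which there are a `G`-subshift `Z` (over some finite
alphabet `C`) with `h(Z) = r` and factor maps `φ : X → Z` and `ψ : Z → Y` with `π = ψ ∘ φ`. -/
def intermediateSubshiftEntropies {G : Type*} [Group G] (F : ℕ → Finset G)
    {A B : Type*} [TopologicalSpace A] [TopologicalSpace B]
    (X : GSubshift G A) (Y : GSubshift G B) (π : X → Y) : Set ℝ :=
  {r | ∃ (C : Type) (_ : Finite C) (_ : TopologicalSpace C) (_ : DiscreteTopology C)
      (Z : GSubshift G C) (φ : X → Z) (ψ : Z → Y),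
      topEntropy F Z = (r : EReal) ∧ IsFactorMap G φ ∧ IsFactorMap G ψ ∧ π = ψ ∘ φ}

end

noncomputable section

open scoped Classical Pointwise symmDiff

/-! ### Counting names -/

section Counting

variable {X α β : Type*}

/-! Let `f` be the symbol of `x` at the identity and `q` that of `π x`. For every clopen `W` the
names of `reveal q f W`, which shows `q` everywhere and `f` only on `W`, form a subshift between `X`
and `Y` (`exists_intermediate`). Its entropy is at most `h(Y)` for `W = ∅`. It therefore suffices to
enlarge `W` in finitely many steps, each raising the entropy by at most `ε`, until it is within `ε`
of `h(X)`; the values along this chain then come within `ε` of each point of the interval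
(`exists_clopen_chain`, `exists_abs_sub_le_of_small_steps`).

A step is cheap if the clopen set added is visited with small frequency: the newly revealed values
form a partial function with few values, and there are few of these (`nameEntropy_reveal_union_le`).
A point with a large orbit has such a neighbourhood (`exists_isClopen_of_notMem_smallOrbits`,
`IsFolnerSeq.eventually_visits_le`).

Points with at most `m` orbit elements are never singled out. Along a set `E` of about `r ^ 2`
quotients of `r` group elements, their names number only `exp (O(r))`, while two of them with
different symbols differ at a number of places of order `r ^ 2` (`exists_predicting_set`). Hence
symbols at sites that look like such points along `E` can be recovered greedily: each guess of a
name along a translate of `E` fixes many new sites at little cost (`ncard_nameOn_le_pow`). The set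
of points that look like this, the shadow, is clopen, so its complement is compact and is covered by
finitely many rarely visited sets; revealing `f` there leaves almost no entropy
(`nameEntropy_le_nameEntropy_reveal_add`).

The two bounds on intermediate entropies are monotonicity under factor maps; finiteness comes from
counting patterns (`GSubshift.topEntropy_eq`). -/

lemma ncard_range_le_mul [Finite α] [Finite β] (f : X → α) (h : X → β) (M : ℕ)
    (H : ∀ x₀, (h '' {x | f x = f x₀}).ncard ≤ M) :
    (Set.range h).ncard ≤ (Set.range f).ncard * M := by
  have := Fintype.ofFinite α
  have := Fintype.ofFinite β
  have e : (Set.range h).toFinset ⊆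
      (Set.range f).toFinset.biUnion fun a => (h '' {x | f x = a}).toFinset := by
    intro b hb
    obtain ⟨x, rfl⟩ := Set.mem_toFinset.1 hb
    simp only [Finset.mem_biUnion, Set.mem_toFinset]
    exact ⟨f x, ⟨x, rfl⟩, x, rfl, rfl⟩
  rw [Set.ncard_eq_toFinset_card', Set.ncard_eq_toFinset_card']
  refine (Finset.card_le_card e).trans (Finset.card_biUnion_le_card_mul _ _ _ ?_)
  intro a ha
  obtain ⟨x, rfl⟩ := Set.mem_toFinset.1 ha
  rw [← Set.ncard_eq_toFinset_card']
  exact H x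

lemma ncard_range_le_of_determines [Finite α] [Finite β] (f : X → α) (h : X → β)
    (H : ∀ x y, f x = f y → h x = h y) :
    (Set.range h).ncard ≤ (Set.range f).ncard := by
  refine (ncard_range_le_mul f h 1 fun x₀ => ?_).trans_eq (mul_one _)
  rw [Set.ncard_le_one]
  rintro _ ⟨x, hx, rfl⟩ _ ⟨y, hy, rfl⟩
  exact H x y (hx.trans hy.symm)

lemma log_natCast_mono {m n : ℕ} (h : m ≤ n) : Real.log m ≤ Real.log n := by
  rcases Nat.eq_zero_or_pos m with rfl | hm
  · simpa using Real.log_natCast_nonneg n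
  · exact Real.log_le_log (by exact_mod_cast hm) (by exact_mod_cast h)

lemma log_natCast_mul_le (m n : ℕ) :
    Real.log ((m * n : ℕ) : ℝ) ≤ Real.log m + Real.log n := by
  rcases Nat.eq_zero_or_pos m with rfl | hm
  · simpa using Real.log_natCast_nonneg n
  rcases Nat.eq_zero_or_pos n with rfl | hn
  · simpa using Real.log_natCast_nonneg m
  push_cast
  rw [Real.log_mul (by positivity) (by positivity)]

end Counting

/-! ### Names and their growth rates -/

section Names

variable {G : Type*} [Group G] {X : Type*} [MulAction G X] {C : Type*}

/-- The `P`-name of a point along a finite set `E`. -/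
def nameOn (P : X → C) (E : Finset G) (x : X) : E → C := fun g => P ((g : G) • x)

/-- The number of `P`-names along a finite set `E`. -/
def nameCount (P : X → C) (E : Finset G) : ℕ := (Set.range (nameOn P E)).ncard

lemma nameOn_eq_iff {P : X → C} {E : Finset G} {x y : X} :
    nameOn P E x = nameOn P E y ↔ ∀ g ∈ E, P (g • x) = P (g • y) := by
  simp [nameOn, funext_iff]

/-- The exponential growth rate of the number of `P`-names along `F`. -/
def nameEntropy (F : ℕ → Finset G) (P : X → C) : EReal :=
  limsup (fun n => ((Real.log (nameCount P (F n)) / ((F n).card : ℝ) : ℝ) : EReal)) atTop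

lemma IsFolnerSeq.card_pos {F : ℕ → Finset G} (hF : IsFolnerSeq F) (n : ℕ) :
    (0 : ℝ) < (F n).card := by
  exact_mod_cast (hF.nonempty n).card_pos

lemma IsFolnerSeq.eventually_card_sdiff {F : ℕ → Finset G} (hF : IsFolnerSeq F)
    (K : Finset G) {κ : ℝ} (hκ : 0 < κ) :
    ∀ᶠ n in atTop, (((K * F n) \ F n).card : ℝ) ≤ κ * (F n).card := by
  rcases K.eq_empty_or_nonempty with rfl | hK
  · refine Eventually.of_forall fun n => ?_
    simp; positivity
  filter_upwards [(hF.tendsto K hK).eventually (gt_mem_nhds hκ)] with n hn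
  rw [div_lt_iff₀ (hF.card_pos n)] at hn
  refine le_trans ?_ hn.le
  exact_mod_cast Finset.card_le_card Finset.subset_union_left

/-- Comparison of growth rates. -/
lemma limsup_le_add_of_eventually_le {u v : ℕ → ℝ} {ε : ℝ}
    (h : ∀ᶠ n in atTop, v n ≤ u n + ε) :
    limsup (fun n => (v n : EReal)) atTop ≤ limsup (fun n => (u n : EReal)) atTop + ε := by
  have h1 : limsup (fun n => (v n : EReal)) atTop
      ≤ limsup ((fun n => (u n : EReal)) + fun _ => (ε : EReal)) atTop := by
    refine limsup_le_limsup ?_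
    filter_upwards [h] with n hn
    simp only [Pi.add_apply]
    exact_mod_cast hn
  refine h1.trans ((EReal.limsup_add_le ?_ ?_).trans_eq ?_)
  · right; simp
  · right; simp
  · simp

lemma nameCount_le_pow [Finite C] (P : X → C) (E : Finset G) :
    nameCount P E ≤ Nat.card C ^ E.card := by
  have := Fintype.ofFinite C
  refine (Set.ncard_le_card _).trans_eq ?_
  simp [Nat.card_eq_fintype_card]

lemma nameCount_le_mul_pow [Finite C] (P : X → C)
    (E E' : Finset G) : nameCount P E' ≤ nameCount P E * Nat.card C ^ (E' \ E).card := by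
  refine ncard_range_le_mul _ _ _ fun x₀ => ?_
  refine le_trans ?_ (nameCount_le_pow P (E' \ E))
  let ι : Set.range (nameOn P (E' \ E)) → (E' → C) := fun c g =>
    if h : (g : G) ∈ E then P ((g : G) • x₀)
    else c.1 ⟨g, Finset.mem_sdiff.2 ⟨g.2, h⟩⟩
  have hsub : nameOn P E' '' {x | nameOn P E x = nameOn P E x₀} ⊆ Set.range ι := by
    rintro _ ⟨x, hx, rfl⟩
    refine ⟨⟨_, x, rfl⟩, ?_⟩
    funext g
    by_cases h : (g : G) ∈ E
    · simp only [ι, h, dif_pos]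
      exact (nameOn_eq_iff.1 hx g h).symm
    · simp only [ι, h, dif_neg, not_false_eq_true]
      rfl
  refine (Set.ncard_le_ncard hsub).trans ?_
  rw [← Set.image_univ]
  refine (Set.ncard_image_le).trans_eq ?_
  rw [Set.ncard_univ, Nat.card_coe_set_eq, nameCount]

/-- Each term of the limsup lies between `0` and `log |C|`. This allows arithmetic with entropies in
`ℝ`. -/
lemma exists_nameEntropy_eq_coe [Finite C] {F : ℕ → Finset G} (hF : IsFolnerSeq F) (P : X → C) :
    ∃ a : ℝ, nameEntropy F P = a := by
  have h0 : ((0 : ℝ) : EReal) ≤ nameEntropy F P := by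
    refine le_limsup_of_frequently_le (Frequently.of_forall fun n => ?_)
    exact_mod_cast div_nonneg (Real.log_natCast_nonneg _) (Nat.cast_nonneg _)
  have h1 : nameEntropy F P ≤ ((Real.log (Nat.card C) : ℝ) : EReal) := by
    refine limsup_le_of_le (h := Eventually.of_forall fun n => ?_)
    refine EReal.coe_le_coe_iff.2 ((div_le_iff₀ (hF.card_pos n)).2 ?_)
    refine (log_natCast_mono (nameCount_le_pow P (F n))).trans_eq ?_
    push_cast
    rw [Real.log_pow, mul_comm]
  refine ⟨(nameEntropy F P).toReal, (EReal.coe_toReal ?_ ?_).symm⟩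
  · exact ne_top_of_le_ne_top (EReal.coe_ne_top _) h1
  · exact ne_bot_of_le_ne_bot (EReal.coe_ne_bot _) h0

lemma nameEntropy_mono {C' X' : Type*} [MulAction G X'] (F : ℕ → Finset G)
    (P : X → C) (Q : X' → C') (h : ∀ n, nameCount P (F n) ≤ nameCount Q (F n)) :
    nameEntropy F P ≤ nameEntropy F Q := by
  refine limsup_le_limsup (Eventually.of_forall fun n => ?_)
  refine EReal.coe_le_coe_iff.2 ?_
  exact div_le_div_of_nonneg_right (log_natCast_mono (h n)) (Nat.cast_nonneg _)

/-- If, up to a factor `exp (ε |F n|)`, there are no more `P`-names than `Q`-names, the growth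
rates differ by at most `ε`. -/
lemma nameEntropy_le_add {C' X' : Type*} [MulAction G X'] {F : ℕ → Finset G}
    (hF : IsFolnerSeq F) (P : X → C) (Q : X' → C') (ε : ℝ) (M : ℕ → ℕ)
    (h : ∀ᶠ n in atTop, nameCount P (F n) ≤ nameCount Q (F n) * M n ∧
      Real.log (M n) ≤ ε * (F n).card) :
    nameEntropy F P ≤ nameEntropy F Q + ε := by
  refine limsup_le_add_of_eventually_le ?_
  filter_upwards [h] with n hn
  have hp := hF.card_pos n
  rw [← sub_le_iff_le_add', ← sub_div, div_le_iff₀ hp]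
  have := (log_natCast_mono hn.1).trans (log_natCast_mul_le _ _)
  linarith [hn.2]

end Names

/-! ### Topological entropy -/

section TopEntropy

variable {G : Type*} [Group G] {X : Type*} [MulAction G X]

lemma joinCover_finite {𝒰 : Set (Set X)} (h : 𝒰.Finite) (E : Finset G) :
    (joinCover 𝒰 E).Finite := by
  have := h.to_subtype
  refine (Set.finite_range fun U : E → 𝒰 =>
    ⋂ g : E, (fun x : X => (g : G) • x) ⁻¹' (U g : Set X)).subset ?_
  rintro V ⟨U, hU, rfl⟩
  refine ⟨fun g => ⟨U g, hU g g.2⟩, ?_⟩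
  ext x; simp

lemma sUnion_joinCover {𝒰 : Set (Set X)} (h : ⋃₀ 𝒰 = Set.univ) (E : Finset G) :
    ⋃₀ joinCover 𝒰 E = Set.univ := by
  refine Set.eq_univ_of_forall fun x => ?_
  have : ∀ g : G, ∃ U ∈ 𝒰, g • x ∈ U := fun g => Set.mem_sUnion.1 (h ▸ Set.mem_univ _)
  choose U hU hx using this
  exact ⟨_, ⟨U, fun g _ => hU g, rfl⟩, by simpa using fun g _ => hx g⟩

lemma coverNumber_le {𝒱 : Set (Set X)} (S : Finset (Set X)) (h : (S : Set (Set X)) ⊆ 𝒱)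
    (hu : ⋃₀ (S : Set (Set X)) = Set.univ) : coverNumber 𝒱 ≤ S.card :=
  Nat.sInf_le ⟨S, h, hu, rfl⟩

lemma exists_card_eq_coverNumber {𝒱 : Set (Set X)} (hf : 𝒱.Finite) (h : ⋃₀ 𝒱 = Set.univ) :
    ∃ S : Finset (Set X), (S : Set (Set X)) ⊆ 𝒱 ∧ ⋃₀ (S : Set (Set X)) = Set.univ ∧
      S.card = coverNumber 𝒱 :=
  Nat.sInf_mem (s := {n | ∃ S : Finset (Set X), (S : Set (Set X)) ⊆ 𝒱 ∧
    ⋃₀ (S : Set (Set X)) = Set.univ ∧ S.card = n})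
    ⟨_, hf.toFinset, by simp, by simpa using h, rfl⟩

/-- A cover is at most as large as any finite family of names that refines it. -/
lemma coverNumber_le_ncard_range {α : Type*} [Finite α] {𝒱 : Set (Set X)} (f : X → α)
    (h : ∀ x, ∃ V ∈ 𝒱, ∀ y, f y = f x → y ∈ V) : coverNumber 𝒱 ≤ (Set.range f).ncard := by
  have := Fintype.ofFinite α
  choose V hV hy using h
  have hc : ∀ a : Set.range f, ∃ x, f x = a := fun a => a.2
  choose c hc using hc
  let S : Finset (Set X) := Finset.univ.image fun a : Set.range f => V (c a)
  refine (coverNumber_le S ?_ ?_).trans ?_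
  · intro U hU
    obtain ⟨a, -, rfl⟩ := Finset.mem_image.1 (Finset.mem_coe.1 hU)
    exact hV _
  · refine Set.eq_univ_of_forall fun x => ?_
    refine ⟨V (c ⟨f x, x, rfl⟩), ?_, hy _ _ (hc ⟨f x, x, rfl⟩).symm⟩
    exact Finset.mem_coe.2 (Finset.mem_image_of_mem _ (Finset.mem_univ _))
  · refine Finset.card_image_le.trans_eq ?_
    rw [Finset.card_univ, ← Nat.card_eq_fintype_card, Nat.card_coe_set_eq]

/-- A finite cover each of whose members carries a single name has at least as many members as
there are names. -/
lemma ncard_range_le_coverNumber {α : Type*} [Finite α] {𝒱 : Set (Set X)} (hf : 𝒱.Finite)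
    (hu : ⋃₀ 𝒱 = Set.univ) (f : X → α)
    (h : ∀ V ∈ 𝒱, ∀ x ∈ V, ∀ y ∈ V, f x = f y) : (Set.range f).ncard ≤ coverNumber 𝒱 := by
  obtain ⟨S, hS, hSu, hc⟩ := exists_card_eq_coverNumber hf hu
  rw [← hc, ← Set.ncard_coe_finset]
  have hx : ∀ x, ∃ V ∈ (S : Set (Set X)), x ∈ V := fun x => Set.mem_sUnion.1 (hSu ▸ Set.mem_univ _)
  choose V hV hxV using hx
  have hc : ∀ a : Set.range f, ∃ x, f x = a := fun a => a.2
  choose c hc using hc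
  have inj : Function.Injective fun a : Set.range f => (⟨V (c a), hV _⟩ : (S : Set (Set X))) := by
    intro a b hab
    have hab' : V (c a) = V (c b) := congrArg Subtype.val hab
    refine Subtype.ext ?_
    rw [← hc a, ← hc b]
    exact h _ (hS (hV (c a))) _ (hxV _) _ (hab' ▸ hxV _)
  rw [← Nat.card_coe_set_eq, ← Nat.card_coe_set_eq]
  exact Nat.card_le_card_of_injective _ inj

lemma coverEntropy_le_topEntropy [TopologicalSpace X] (F : ℕ → Finset G) {𝒰 : Set (Set X)}
    (hf : 𝒰.Finite) (ho : ∀ U ∈ 𝒰, IsOpen U) (hu : ⋃₀ 𝒰 = Set.univ) :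
    coverEntropy F 𝒰 ≤ topEntropy F X :=
  le_iSup_of_le 𝒰 <| le_iSup_of_le hf <| le_iSup_of_le ho <| le_iSup_of_le hu le_rfl

lemma topEntropy_le [TopologicalSpace X] (F : ℕ → Finset G) {a : EReal}
    (h : ∀ 𝒰 : Set (Set X), 𝒰.Finite → (∀ U ∈ 𝒰, IsOpen U) → ⋃₀ 𝒰 = Set.univ →
      coverEntropy F 𝒰 ≤ a) : topEntropy F X ≤ a :=
  iSup_le fun 𝒰 => iSup_le fun hf => iSup_le fun ho => iSup_le fun hu => h 𝒰 hf ho hu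

/-- Entropy does not increase under factor maps. -/
lemma IsFactorMap.topEntropy_le {Y : Type*} [MulAction G Y] [TopologicalSpace X]
    [TopologicalSpace Y] (F : ℕ → Finset G) {f : X → Y} (h : IsFactorMap G f) :
    topEntropy F Y ≤ topEntropy F X := by
  refine _root_.topEntropy_le F fun 𝒰 hf ho hu => ?_
  have hf' : ((f ⁻¹' ·) '' 𝒰).Finite := hf.image _
  have hu' : ⋃₀ ((f ⁻¹' ·) '' 𝒰) = Set.univ := by
    rw [Set.sUnion_image, ← Set.preimage_iUnion₂, ← Set.sUnion_eq_biUnion, hu, Set.preimage_univ]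
  refine le_trans ?_ (coverEntropy_le_topEntropy F hf' ?_ hu')
  · refine limsup_le_limsup (Eventually.of_forall fun n => EReal.coe_le_coe_iff.2 ?_)
    refine div_le_div_of_nonneg_right (log_natCast_mono ?_) (Nat.cast_nonneg _)
    obtain ⟨S, hS, hSu, hc⟩ := exists_card_eq_coverNumber (joinCover_finite hf' (F n))
      (sUnion_joinCover hu' (F n))
    rw [← hc]
    have hV : ∀ V : S, ∃ W ∈ joinCover 𝒰 (F n), (V : Set X) ⊆ f ⁻¹' W := by
      rintro ⟨V, hV⟩
      obtain ⟨U, hU, rfl⟩ := hS hV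
      choose! U' hU' hUU' using hU
      refine ⟨_, ⟨U', hU', rfl⟩, ?_⟩
      intro x hx
      simp only [Set.mem_iInter, Set.mem_preimage] at hx ⊢
      intro g hg
      have := hx g hg
      rw [← hUU' g hg] at this
      rw [← h.map_smul]
      exact this
    choose W hW hVW using hV
    refine (coverNumber_le (Finset.univ.image W) ?_ ?_).trans
      (Finset.card_image_le.trans_eq (by simp))
    · intro V hV
      obtain ⟨a, -, rfl⟩ := Finset.mem_image.1 (Finset.mem_coe.1 hV)
      exact hW a
    · refine Set.eq_univ_of_forall fun y => ?_
      obtain ⟨x, rfl⟩ := h.surjective y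
      obtain ⟨V, hVS, hxV⟩ : ∃ V ∈ (S : Set (Set X)), x ∈ V :=
        Set.mem_sUnion.1 (hSu ▸ Set.mem_univ _)
      exact ⟨W ⟨V, hVS⟩, Finset.mem_coe.2 (Finset.mem_image_of_mem _ (Finset.mem_univ _)),
        hVW ⟨V, hVS⟩ hxV⟩
  · rintro _ ⟨U, hU, rfl⟩
    exact (ho U hU).preimage h.continuous

end TopEntropy

/-! ### Points with small orbits -/

section SmallOrbits

variable {G : Type*} [Group G] {X : Type*} [MulAction G X]

/-- The points whose orbit has at most `m` elements. -/
def smallOrbits (G : Type*) [Group G] (X : Type*) [MulAction G X] (m : ℕ) : Set X :=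
  {x | (MulAction.orbit G x).encard ≤ m}

/-- In an infinite group there are arbitrarily long finite sequences whose quotients
`(g j)⁻¹ * g i` with `j < i` are distinct. -/
lemma exists_quotients_distinct (G : Type*) [Group G] [Infinite G] (r : ℕ) :
    ∃ g : ℕ → G, (∀ i j, i < r → j < r → g i = g j → i = j) ∧
      ∀ i j k l, j < i → i < r → l < k → k < r →
        (g j)⁻¹ * g i = (g l)⁻¹ * g k → i = k ∧ j = l := by
  induction r with
  | zero => exact ⟨1, by simp⟩
  | succ r ih =>
    obtain ⟨g, hinj, hg⟩ := ih
    -- The new element avoids every `g j * ((g l)⁻¹ * g k)`, so no new quotient `(g j)⁻¹ * y` is an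
    -- old one, and every `g i`, which preserves injectivity. Injectivity separates the new
    -- quotients from each other.
    obtain ⟨y, hy⟩ := Infinite.exists_notMem_finset
      (((Finset.range r ×ˢ Finset.range r) ×ˢ Finset.range r).image
        (fun p : (ℕ × ℕ) × ℕ => g p.2 * ((g p.1.1)⁻¹ * g p.1.2)) ∪ (Finset.range r).image g)
    simp only [Finset.mem_union, Finset.mem_image, Finset.mem_product, Finset.mem_range,
      not_or, not_exists, not_and, Prod.forall] at hy
    have hnew : ∀ j l k, j < r → l < k → k < r → (g j)⁻¹ * y ≠ (g l)⁻¹ * g k := by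
      intro j l k hj hl hk h
      exact hy.1 l k j ⟨⟨hl.trans hk, hk⟩, hj⟩ (by rw [← h]; group)
    refine ⟨Function.update g r y, ?_, ?_⟩
    · intro i j hi hj h
      rcases eq_or_ne i r with rfl | hir <;> rcases eq_or_ne j i with rfl | hji
      · rfl
      · rw [Function.update_self, Function.update_of_ne hji] at h
        exact absurd h.symm (hy.2 j (by omega))
      · rfl
      · rw [Function.update_of_ne hir] at h
        rcases eq_or_ne j r with rfl | hjr
        · rw [Function.update_self] at h
          exact absurd h (hy.2 i (by omega))
        · rw [Function.update_of_ne hjr] at h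
          exact hinj i j (by omega) (by omega) h
    · intro i j k l hji hi hlk hk h
      have hj : j ≠ r := by omega
      have hl : l ≠ r := by omega
      rw [Function.update_of_ne hj, Function.update_of_ne hl] at h
      by_cases hir : i = r <;> by_cases hkr : k = r
      · subst hir hkr
        exact ⟨rfl, hinj j l hji hlk (by simpa using h)⟩
      · subst hir
        rw [Function.update_self, Function.update_of_ne hkr] at h
        exact absurd h (hnew _ _ _ hji hlk (by omega))
      · subst hkr
        rw [Function.update_self, Function.update_of_ne hir] at h
        exact absurd h.symm (hnew _ _ _ hlk hji (by omega))
      · rw [Function.update_of_ne hir, Function.update_of_ne hkr] at h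
        exact hg i j k l hji (by omega) hlk (by omega) h

lemma card_offDiag_le_two_mul (s : Finset ℕ) :
    s.offDiag.card ≤ 2 * ((s ×ˢ s).filter fun p => p.1 < p.2).card := by
  have hsub : s.offDiag ⊆ ((s ×ˢ s).filter fun p => p.1 < p.2) ∪
      ((s ×ˢ s).filter fun p => p.1 < p.2).image Prod.swap := by
    rintro ⟨a, b⟩ h
    simp only [Finset.mem_offDiag] at h
    simp only [Finset.mem_union, Finset.mem_filter, Finset.mem_product, Finset.mem_image,
      Prod.exists, Prod.swap_prod_mk, Prod.mk.injEq]
    rcases lt_or_gt_of_ne h.2.2 with hab | hab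
    · exact Or.inl ⟨⟨h.1, h.2.1⟩, hab⟩
    · exact Or.inr ⟨b, a, ⟨⟨h.2.1, h.1⟩, hab⟩, rfl, rfl⟩
  refine (Finset.card_le_card hsub).trans ((Finset.card_union_le _ _).trans ?_)
  have := Finset.card_image_le (s := (s ×ˢ s).filter fun p => p.1 < p.2) (f := Prod.swap)
  omega

lemma finite_orbit_of_mem_smallOrbits {m : ℕ} {x : X} (hx : x ∈ smallOrbits G X m) :
    (MulAction.orbit G x).Finite :=
  Set.finite_of_encard_le_coe hx

lemma ncard_orbit_le_of_mem_smallOrbits {m : ℕ} {x : X} (hx : x ∈ smallOrbits G X m) :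
    (MulAction.orbit G x).ncard ≤ m := by
  have h : (MulAction.orbit G x).encard ≤ m := hx
  rw [← (finite_orbit_of_mem_smallOrbits hx).cast_ncard_eq] at h
  exact_mod_cast h

/-- The number of names of points with small orbits along a set of quotients. -/
lemma ncard_nameOn_smallOrbits_le {A : Type*} [Finite A] (f : X → A) (m r : ℕ) (g : ℕ → G)
    (E : Finset G) (hE : ∀ h ∈ E, ∃ i j : Fin r, h = (g j)⁻¹ * g i) :
    (nameOn f E '' smallOrbits G X m).ncard ≤ m ^ r * (Nat.card A) ^ (r * m) := by
  have := Fintype.ofFinite A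
  have hE' : ∀ h : E, ∃ p : Fin r × Fin r, (h : G) = (g p.2)⁻¹ * g p.1 := fun h =>
    let ⟨i, j, hij⟩ := hE h h.2
    ⟨(i, j), hij⟩
  choose p hp using hE'
  -- Label the orbit of `x` by `Fin m`. The name is recovered from the labels of the points `g i •
  -- x` and the table of `f ((g j)⁻¹ • z)` for `z` in the orbit, hence from data whose size is
  -- linear in `r`.
  let Ψ : (Fin r → Fin m) × (Fin r × Fin m → A) → (E → A) :=
    fun ct h => ct.2 ((p h).2, ct.1 (p h).1)
  have hsub : nameOn f E '' smallOrbits G X m ⊆ Set.range Ψ := by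
    rintro _ ⟨x, hx, rfl⟩
    have hfin := finite_orbit_of_mem_smallOrbits hx
    have := hfin.to_subtype
    have := Fintype.ofFinite (MulAction.orbit G x)
    obtain ⟨e⟩ : Nonempty (MulAction.orbit G x ↪ Fin m) := by
      refine Function.Embedding.nonempty_of_card_le ?_
      rw [Fintype.card_fin, ← Nat.card_eq_fintype_card, Nat.card_coe_set_eq]
      exact ncard_orbit_le_of_mem_smallOrbits hx
    have : Nonempty (MulAction.orbit G x) := ⟨⟨x, MulAction.mem_orbit_self x⟩⟩
    refine ⟨(fun i => e ⟨g i • x, MulAction.mem_orbit _ _⟩,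
      fun jk => f ((g jk.1)⁻¹ • ((Function.invFun e jk.2 : MulAction.orbit G x) : X))), ?_⟩
    funext h
    simp only [Ψ, nameOn]
    rw [Function.leftInverse_invFun e.injective, hp h, mul_smul]
  refine (Set.ncard_le_ncard hsub).trans ?_
  rw [← Set.image_univ]
  refine (Set.ncard_image_le).trans_eq ?_
  rw [Set.ncard_univ, Nat.card_eq_fintype_card, Nat.card_eq_fintype_card]
  simp [pow_mul]

/-- Names of points with small orbits are few and far apart along a suitable finite set. -/
lemma exists_predicting_set [Infinite G] {A : Type*} [Finite A] (f : X → A) (m : ℕ) (hm : 1 ≤ m)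
    {ε : ℝ} (hε : 0 < ε) :
    ∃ (E : Finset G) (D N : ℕ), 0 < D ∧ 1 ≤ N ∧ Real.log N ≤ ε * D ∧
      (nameOn f E '' smallOrbits G X m).ncard ≤ N ∧
      ∀ x ∈ smallOrbits G X m, ∀ y ∈ smallOrbits G X m, f x ≠ f y →
        D ≤ (E.filter fun h => f (h • x) ≠ f (h • y)).card := by
  -- With `r = m * m * q`, the count `N` below has `log N = q * L`, while `D = p * q`; so `p ≥ L /
  -- ε` is what is needed. The `+ 1` keeps `N` positive even when `A` is empty.
  set L : ℝ := (m * m : ℕ) * (Real.log m + m * Real.log (Nat.card A + 1 : ℕ)) with hL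
  obtain ⟨p, hp⟩ := exists_nat_ge (max (L / ε) 1)
  have hp1 : 1 ≤ p := by exact_mod_cast (le_max_right _ _).trans hp
  have hpL : L ≤ p * ε := (div_le_iff₀ hε).1 ((le_max_left _ _).trans hp)
  set q := 2 * p + 1 with hq
  set r := m * m * q with hr
  obtain ⟨g, hinj, hg⟩ := exists_quotients_distinct G r
  set I := ((Finset.range r ×ˢ Finset.range r).filter fun p => p.1 < p.2) with hI
  set E : Finset G := I.image fun p => (g p.1)⁻¹ * g p.2 with hE
  refine ⟨E, p * q, m ^ r * (Nat.card A + 1) ^ (r * m), by positivity, ?_, ?_, ?_, ?_⟩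
  · exact Nat.one_le_iff_ne_zero.2 (by positivity)
  · push_cast
    rw [Real.log_mul (by positivity) (by positivity), Real.log_pow, Real.log_pow]
    have : (r : ℝ) * Real.log m + (r * m : ℕ) * Real.log (Nat.card A + 1) = q * L := by
      rw [hL, hr]; push_cast; ring
    rw [this]
    nlinarith [Nat.cast_nonneg (α := ℝ) q]
  · refine (ncard_nameOn_smallOrbits_le f m r g E ?_).trans ?_
    · intro h hh
      obtain ⟨⟨j, i⟩, hji, rfl⟩ := Finset.mem_image.1 hh
      simp only [hI, Finset.mem_filter, Finset.mem_product, Finset.mem_range] at hji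
      exact ⟨⟨i, hji.1.2⟩, ⟨j, hji.1.1⟩, rfl⟩
    · gcongr; omega
  · intro x hx y hy hxy
    have hfx := finite_orbit_of_mem_smallOrbits hx
    have hfy := finite_orbit_of_mem_smallOrbits hy
    -- Pigeonhole: the `m * m * q` indices `i` have at most `m * m` values `(g i • x, g i • y)`, so
    -- `q` indices share one. Each pair `j < i` of them gives a quotient fixing both `x` and `y`, at
    -- which the two names differ; `q = 2 * p + 1` makes the number of pairs at least `p * q`.
    obtain ⟨z, -, hz⟩ := Finset.exists_le_card_fiber_of_mul_le_card_of_maps_to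
      (s := Finset.range r) (t := hfx.toFinset ×ˢ hfy.toFinset) (n := q)
      (f := fun i => (g i • x, g i • y)) (by
        intro i _
        simp [MulAction.mem_orbit]) ⟨(x, y), by simp⟩ (by
        rw [Finset.card_product, Finset.card_range, ← Set.ncard_eq_toFinset_card _ hfx,
          ← Set.ncard_eq_toFinset_card _ hfy, hr]
        gcongr <;> exact ncard_orbit_le_of_mem_smallOrbits (by assumption))
    set s := (Finset.range r).filter fun i => (g i • x, g i • y) = z with hs
    set J := (s ×ˢ s).filter fun p => p.1 < p.2 with hJ
    have hJcard : p * q ≤ J.card := by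
      have h1 := card_offDiag_le_two_mul s
      rw [Finset.offDiag_card, ← hJ] at h1
      have h2 : q * (2 * p) ≤ s.card * (s.card - 1) := Nat.mul_le_mul hz (by omega)
      rw [Nat.mul_sub_one] at h2
      have h3 : q * (2 * p) ≤ 2 * J.card := h2.trans h1
      nlinarith
    refine hJcard.trans ?_
    refine Finset.card_le_card_of_injOn (fun p => (g p.1)⁻¹ * g p.2) ?_ ?_
    · rintro ⟨j, i⟩ hji
      simp only [hJ, hs, Finset.coe_filter, Finset.mem_product, Finset.mem_filter,
        Finset.mem_range, Set.mem_ofPred_eq] at hji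
      obtain ⟨⟨⟨hj, hjz⟩, hi, hiz⟩, hlt⟩ := hji
      have hxx : g j • x = g i • x := congrArg Prod.fst (hjz.trans hiz.symm)
      have hyy : g j • y = g i • y := congrArg Prod.snd (hjz.trans hiz.symm)
      have hx' : ((g j)⁻¹ * g i) • x = x := by rw [mul_smul, ← hxx, inv_smul_smul]
      have hy' : ((g j)⁻¹ * g i) • y = y := by rw [mul_smul, ← hyy, inv_smul_smul]
      simp only [Finset.coe_filter, Set.mem_ofPred_eq, hx', hy']
      refine ⟨Finset.mem_image.2 ⟨(j, i), ?_, rfl⟩, hxy⟩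
      simp [hI, hj, hi, hlt]
    · rintro ⟨j, i⟩ hji ⟨l, k⟩ hlk h
      simp only [hJ, hs, Finset.coe_filter, Finset.mem_product, Finset.mem_filter,
        Finset.mem_range, Set.mem_ofPred_eq] at hji hlk
      obtain ⟨rfl, rfl⟩ := hg i j k l hji.2 hji.1.2.1 hlk.2 hlk.1.2.1 h
      rfl

/-- If every point of `𝒳` visits the sites of `O` in a set on which the names along `E` are
those of `B`, the names of `𝒳` along `H` are few given their values off `O`. -/
lemma ncard_nameOn_le_pow {A : Type*} [Finite A] (f : X → A) (B : Set X) (E : Finset G) (D N : ℕ)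
    (hN : 1 ≤ N) (hBN : (nameOn f E '' B).ncard ≤ N)
    (hBD : ∀ x ∈ B, ∀ y ∈ B, f x ≠ f y → D ≤ (E.filter fun h => f (h • x) ≠ f (h • y)).card)
    (H O : Finset G) (hO : O ⊆ H) (k : ℕ) :
    ∀ (S : Finset G) (𝒳 : Set X), ((E * H) \ S).card < (k + 1) * D →
      (∀ x ∈ 𝒳, ∀ y ∈ 𝒳, ∀ g ∈ S, f (g • x) = f (g • y)) →
      (∀ x ∈ 𝒳, ∀ y ∈ 𝒳, ∀ g ∈ H \ O, f (g • x) = f (g • y)) →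
      (∀ x ∈ 𝒳, ∀ g ∈ O, ∃ b ∈ B, f (g • x) = f b ∧ ∀ h ∈ E, f (h • g • x) = f (h • b)) →
      (nameOn f H '' 𝒳).ncard ≤ N ^ k := by
  have := Fintype.ofFinite A
  -- If two points differed at `g ∈ O`, they would imitate two points of `B` that differ at `D`
  -- places of `E`; but outside `S` there are fewer than `D` sites of `E * g` where they can differ.
  have key : ∀ (S : Finset G) (𝒳 : Set X), (∀ g ∈ O, ((E.image (· * g)) \ S).card < D) →
      (∀ x ∈ 𝒳, ∀ y ∈ 𝒳, ∀ g ∈ S, f (g • x) = f (g • y)) →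
      (∀ x ∈ 𝒳, ∀ y ∈ 𝒳, ∀ g ∈ H \ O, f (g • x) = f (g • y)) →
      (∀ x ∈ 𝒳, ∀ g ∈ O, ∃ b ∈ B, f (g • x) = f b ∧ ∀ h ∈ E, f (h • g • x) = f (h • b)) →
      (nameOn f H '' 𝒳).ncard ≤ 1 := by
    intro S 𝒳 hS hagree hoff hW
    rw [Set.ncard_le_one]
    rintro _ ⟨x, hx, rfl⟩ _ ⟨y, hy, rfl⟩
    refine nameOn_eq_iff.2 fun g hg => ?_
    by_cases hgO : g ∈ O
    · by_contra hne
      obtain ⟨b, hb, hxb, hxE⟩ := hW x hx g hgO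
      obtain ⟨c, hc, hyc, hyE⟩ := hW y hy g hgO
      refine absurd (hBD b hb c hc (by rwa [← hxb, ← hyc])) (not_le.2 ?_)
      refine lt_of_le_of_lt ?_ (hS g hgO)
      refine Finset.card_le_card_of_injOn (· * g) ?_ (mul_left_injective g).injOn
      intro h hh
      obtain ⟨hhE, hhne⟩ := Finset.mem_filter.1 (Finset.mem_coe.1 hh)
      refine Finset.mem_coe.2 (Finset.mem_sdiff.2 ⟨Finset.mem_image_of_mem _ hhE, fun hhS => ?_⟩)
      refine hhne ?_
      have := hagree x hx y hy _ hhS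
      rwa [mul_smul, mul_smul, hxE h hhE, hyE h hhE] at this
    · exact hoff x hx y hy g (Finset.mem_sdiff.2 ⟨hg, hgO⟩)
  have hsub : ∀ g ∈ O, E.image (· * g) ⊆ E * H := by
    intro g hg _ hk
    obtain ⟨h, hh, rfl⟩ := Finset.mem_image.1 hk
    exact Finset.mul_mem_mul hh (hO hg)
  induction k with
  | zero =>
    intro S 𝒳 hS hagree hoff hW
    rw [pow_zero]
    refine key S 𝒳 (fun g hg => ?_) hagree hoff hW
    rw [zero_add, one_mul] at hS
    exact (Finset.card_le_card (Finset.sdiff_subset_sdiff (hsub g hg) le_rfl)).trans_lt hS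
  | succ k ih =>
    intro S 𝒳 hS hagree hoff hW
    -- Greedy step: guess the name along `E * g`, one of at most `N`, and add these sites to `S`. At
    -- least `D` unknown sites disappear, which pays for lowering `k`.
    by_cases hex : ∃ g ∈ O, D ≤ ((E.image (· * g)) \ S).card
    · obtain ⟨g, hg, hgD⟩ := hex
      have hcover : (nameOn f H '' 𝒳).toFinset ⊆ (nameOn f E '' B).toFinset.biUnion fun c =>
          (nameOn f H '' {x ∈ 𝒳 | nameOn f E (g • x) = c}).toFinset := by
        intro a ha
        obtain ⟨x, hx, rfl⟩ := Set.mem_toFinset.1 ha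
        simp only [Finset.mem_biUnion, Set.mem_toFinset]
        obtain ⟨b, hb, -, hbE⟩ := hW x hx g hg
        exact ⟨_, ⟨b, hb, rfl⟩, x, ⟨hx, nameOn_eq_iff.2 hbE⟩, rfl⟩
      rw [Set.ncard_eq_toFinset_card', pow_succ']
      refine (Finset.card_le_card hcover).trans ?_
      refine (Finset.card_biUnion_le_card_mul _ _ (N ^ k) fun c _ => ?_).trans
        (Nat.mul_le_mul_right _ (by rwa [← Set.ncard_eq_toFinset_card']))
      rw [← Set.ncard_eq_toFinset_card']
      refine ih (S ∪ E.image (· * g)) _ ?_ ?_ (fun x hx y hy => hoff x hx.1 y hy.1)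
        fun x hx => hW x hx.1
      · have h1 : ((E * H) \ (S ∪ E.image (· * g))).card + (E.image (· * g) \ S).card
            ≤ ((E * H) \ S).card := by
          rw [← Finset.card_union_of_disjoint]
          · refine Finset.card_le_card ?_
            intro a ha
            simp only [Finset.mem_union, Finset.mem_sdiff, not_or] at ha ⊢
            rcases ha with ha | ha
            · exact ⟨ha.1, ha.2.1⟩
            · exact ⟨hsub g hg ha.1, ha.2⟩
          · rw [Finset.disjoint_left]
            intro a ha hb
            simp only [Finset.mem_union, Finset.mem_sdiff, not_or] at ha hb
            exact ha.2.2 hb.1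
        have h2 : (k + 1 + 1) * D = (k + 1) * D + D := by ring
        omega
      · rintro x ⟨hx, hxc⟩ y ⟨hy, hyc⟩ a ha
        rcases Finset.mem_union.1 ha with ha | ha
        · exact hagree x hx y hy a ha
        · obtain ⟨h, hh, rfl⟩ := Finset.mem_image.1 ha
          rw [mul_smul, mul_smul]
          exact nameOn_eq_iff.1 (hxc.trans hyc.symm) h hh
    · push Not at hex
      exact (key S 𝒳 hex hagree hoff hW).trans (Nat.one_le_pow _ _ hN)

end SmallOrbits

/-! ### Subshifts -/

namespace GSubshift

variable {G : Type*} [Group G] {A : Type*} [TopologicalSpace A]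

lemma smul_apply (X : GSubshift G A) (g : G) (x : X) (h : G) : (g • x).1 h = x.1 (h * g) := rfl

/-- The symbol at the identity. -/
def symbol (X : GSubshift G A) (x : X) : A := x.1 1

lemma symbol_smul (X : GSubshift G A) (g : G) (x : X) : X.symbol (g • x) = x.1 g := by
  rw [symbol, smul_apply, one_mul]

lemma continuous_symbol (X : GSubshift G A) : Continuous X.symbol :=
  (continuous_apply (1 : G)).comp continuous_subtype_val

instance (X : GSubshift G A) : ContinuousConstSMul G X where
  continuous_const_smul g := by
    refine Continuous.subtype_mk (continuous_pi fun h => ?_) _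
    exact (continuous_apply (h * g)).comp continuous_subtype_val

instance (X : GSubshift G A) [CompactSpace A] : CompactSpace X :=
  isCompact_iff_compactSpace.1 X.isClosed.isCompact

/-- The members of an open cover contain the cylinders over some finite window. -/
lemma exists_window [Finite A] [DiscreteTopology A] (X : GSubshift G A) (𝒰 : Set (Set X))
    (ho : ∀ U ∈ 𝒰, IsOpen U) (hu : ⋃₀ 𝒰 = Set.univ) :
    ∃ K : Finset G, ∀ x : X, ∃ U ∈ 𝒰, ∀ y : X, (∀ k ∈ K, y.1 k = x.1 k) → y ∈ U := by
  have hloc : ∀ x : X, ∃ K : Finset G, ∃ U ∈ 𝒰,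
      ∀ y : X, (∀ k ∈ K, y.1 k = x.1 k) → y ∈ U := by
    intro x
    obtain ⟨U, hU, hx⟩ : ∃ U ∈ 𝒰, x ∈ U := Set.mem_sUnion.1 (hu ▸ Set.mem_univ _)
    obtain ⟨V, hV, rfl⟩ := isOpen_induced_iff.1 (ho U hU)
    obtain ⟨K, u, hKu, hKV⟩ := isOpen_pi_iff.1 hV x.1 hx
    exact ⟨K, _, hU, fun y hy => hKV fun k hk => by
      rw [hy k hk]; exact (hKu k hk).2⟩
  choose K U hU hy using hloc
  have hopen : ∀ x : X, IsOpen {y : X | ∀ k ∈ K x, y.1 k = x.1 k} := by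
    intro x
    have : {y : X | ∀ k ∈ K x, y.1 k = x.1 k} = ⋂ k ∈ K x, {y : X | y.1 k = x.1 k} := by
      ext; simp
    rw [this]
    refine isOpen_biInter_finset fun k _ => ?_
    have hk : Continuous fun y : X => y.1 k := (continuous_apply k).comp continuous_subtype_val
    exact (isOpen_discrete {x.1 k}).preimage hk
  obtain ⟨t, ht⟩ := isCompact_univ.elim_finite_subcover _ hopen
    (fun x _ => Set.mem_iUnion.2 ⟨x, fun _ _ => rfl⟩)
  refine ⟨t.biUnion K, fun x => ?_⟩
  obtain ⟨z, hz, hxz⟩ := Set.mem_iUnion₂.1 (ht (Set.mem_univ x))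
  refine ⟨U z, hU z, fun y hxy => hy z y fun k hk => ?_⟩
  rw [hxy k (Finset.mem_biUnion.2 ⟨z, hz, hk⟩), hxz k hk]

/-- The entropy of a subshift is the growth rate of the number of its patterns. -/
theorem topEntropy_eq [Finite A] [DiscreteTopology A] {F : ℕ → Finset G} (hF : IsFolnerSeq F)
    (X : GSubshift G A) : topEntropy F X = nameEntropy F X.symbol := by
  apply le_antisymm
  · refine topEntropy_le F fun 𝒰 hf ho hu => ?_
    obtain ⟨K, hK⟩ := X.exists_window 𝒰 ho hu
    obtain ⟨a, ha⟩ := exists_nameEntropy_eq_coe hF X.symbol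
    refine EReal.le_of_forall_lt_iff_le.1 fun b hb => ?_
    have hab : 0 < b - a := by
      rw [ha] at hb
      exact sub_pos.2 (EReal.coe_lt_coe_iff.1 hb)
    have hlog : 0 ≤ Real.log (Nat.card A) := Real.log_natCast_nonneg _
    -- The window `K` adds at most `κ |F n|` sites, costing `κ log |A|` per site of `F n`; this `κ`
    -- keeps the cost below `b - a`, with `+ 1` guarding against `log |A| = 0`.
    have hκ : 0 < (b - a) / (Real.log (Nat.card A) + 1) := by positivity
    have hb' : (b : EReal) = nameEntropy F X.symbol + ((b - a : ℝ) : EReal) := by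
      rw [ha, ← EReal.coe_add, add_sub_cancel]
    rw [hb']
    refine limsup_le_add_of_eventually_le ?_
    filter_upwards [hF.eventually_card_sdiff K hκ] with n hn
    have hp := hF.card_pos n
    rw [← sub_le_iff_le_add', ← sub_div, div_le_iff₀ hp, sub_le_iff_le_add']
    have h1 : coverNumber (joinCover 𝒰 (F n)) ≤
        nameCount X.symbol (F n) * Nat.card A ^ ((K * F n) \ F n).card := by
      refine le_trans ?_ (nameCount_le_mul_pow X.symbol (F n) (K * F n))
      refine coverNumber_le_ncard_range _ fun x => ?_
      choose U hU hUy using fun g : G => hK (g • x)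
      refine ⟨_, ⟨U, fun g _ => hU g, rfl⟩, fun y hy => ?_⟩
      simp only [Set.mem_iInter, Set.mem_preimage]
      intro g hg
      refine hUy g _ fun k hk => ?_
      have := nameOn_eq_iff.1 hy (k * g) (Finset.mul_mem_mul hk hg)
      rwa [X.symbol_smul, X.symbol_smul] at this
    refine (log_natCast_mono h1).trans ((log_natCast_mul_le _ _).trans ?_)
    gcongr
    push_cast
    rw [Real.log_pow]
    calc (((K * F n) \ F n).card : ℝ) * Real.log (Nat.card A)
        ≤ ((b - a) / (Real.log (Nat.card A) + 1) * (F n).card) * (Real.log (Nat.card A) + 1) := by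
          gcongr; linarith
      _ = (b - a) * (F n).card := by field_simp
  · let 𝒰 : Set (Set X) := Set.range fun a : A => X.symbol ⁻¹' {a}
    have hf : 𝒰.Finite := Set.finite_range _
    have hu : ⋃₀ 𝒰 = Set.univ :=
      Set.eq_univ_of_forall fun x => ⟨_, ⟨X.symbol x, rfl⟩, rfl⟩
    refine le_trans ?_ (coverEntropy_le_topEntropy F hf ?_ hu)
    · refine limsup_le_limsup (Eventually.of_forall fun n => EReal.coe_le_coe_iff.2 ?_)
      refine div_le_div_of_nonneg_right (log_natCast_mono ?_) (Nat.cast_nonneg _)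
      refine ncard_range_le_coverNumber (joinCover_finite hf _) (sUnion_joinCover hu _) _ ?_
      rintro _ ⟨U, hU, rfl⟩ x hx y hy
      refine nameOn_eq_iff.2 fun g hg => ?_
      obtain ⟨a, ha⟩ := hU g hg
      simp only [Set.mem_iInter, Set.mem_preimage] at hx hy
      have h1 := hx g hg
      have h2 := hy g hg
      rw [← ha] at h1 h2
      exact h1.trans h2.symm
    · rintro _ ⟨a, rfl⟩
      exact (isOpen_discrete _).preimage X.continuous_symbol

/-- The subshift of all `P`-names of points of `X`. -/
def nameShift [Finite A] {C : Type*} [TopologicalSpace C] [T2Space C] (X : GSubshift G A)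
    (P : X → C) (hP : Continuous P) : GSubshift G C where
  carrier := Set.range fun (x : X) (g : G) => P (g • x)
  isClosed := (isCompact_range
    (continuous_pi fun g => hP.comp (continuous_const_smul g))).isClosed
  shift_mem := by
    rintro g _ ⟨x, rfl⟩
    exact ⟨g • x, funext fun h => by simp [shiftBy, mul_smul]⟩

end GSubshift

section Intermediate

variable {G : Type*} [Group G] {A B : Type*} [Finite A] [TopologicalSpace A]
  [TopologicalSpace B] {X : GSubshift G A} {Y : GSubshift G B}

/-- A continuous observable through which `π` factors gives an intermediate subshift. -/
lemma exists_intermediate {F : ℕ → Finset G} (hF : IsFolnerSeq F) {π : X → Y}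
    (hπ : IsFactorMap G π) {C : Type*} [Finite C] [TopologicalSpace C] [DiscreteTopology C]
    (P : X → C) (hP : Continuous P) (β : C → B) (hβ : ∀ x, β (P x) = Y.symbol (π x)) {r : ℝ}
    (hr : nameEntropy F P = r) : r ∈ intermediateSubshiftEntropies F X Y π := by
  -- Relabelling by `Fin n` is needed because intermediate subshifts must have an alphabet in
  -- `Type`, whereas `C` may live in any universe.
  obtain ⟨n, ⟨e⟩⟩ := Finite.exists_equiv_fin C
  let Q : X → Fin n := e ∘ P
  have hQ : Continuous Q := continuous_of_discreteTopology.comp hP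
  let Z := X.nameShift Q hQ
  let φ : X → Z := fun x => ⟨fun g => Q (g • x), x, rfl⟩
  have hψ : ∀ x : X, (fun g => β (e.symm (Q (g • x)))) = (π x).1 := by
    intro x
    funext g
    simp only [Q, Function.comp_apply, Equiv.symm_apply_apply]
    rw [hβ, hπ.map_smul, Y.symbol_smul]
  let ψ : Z → Y := fun z => ⟨fun g => β (e.symm (z.1 g)), by
    obtain ⟨x, hx⟩ := z.2
    rw [← hx, hψ]
    exact (π x).2⟩
  have hψφ : π = ψ ∘ φ := funext fun x => Subtype.ext (hψ x).symm
  have hsymb : ∀ (g : G) (x : X), Z.symbol (g • φ x) = e (P (g • x)) := fun g x => Z.symbol_smul _ _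
  refine ⟨Fin n, inferInstance, inferInstance, inferInstance, Z, φ, ψ, ?_, ⟨?_, ?_, ?_⟩,
    ⟨?_, ?_, ?_⟩, hψφ⟩
  · rw [GSubshift.topEntropy_eq hF, ← hr]
    have hcount : ∀ E : Finset G, nameCount Z.symbol E = nameCount Q E := by
      intro E
      rw [nameCount, nameCount]
      congr 1
      ext c
      constructor
      · rintro ⟨⟨_, x, rfl⟩, rfl⟩
        exact ⟨x, funext fun g => (hsymb g x).symm⟩
      · rintro ⟨x, rfl⟩
        exact ⟨φ x, funext fun g => hsymb g x⟩
    apply le_antisymm <;> refine nameEntropy_mono F _ _ fun n => ?_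
    · rw [hcount]
      refine ncard_range_le_of_determines _ _ fun x y h => ?_
      exact nameOn_eq_iff.2 fun g hg => congrArg e (nameOn_eq_iff.1 h g hg)
    · rw [hcount]
      refine ncard_range_le_of_determines _ _ fun x y h => ?_
      exact nameOn_eq_iff.2 fun g hg => e.injective (nameOn_eq_iff.1 h g hg)
  · exact Continuous.subtype_mk
      (continuous_pi fun g => hQ.comp (continuous_const_smul g)) _
  · rintro ⟨_, x, rfl⟩
    exact ⟨x, rfl⟩
  · intro g x
    refine Subtype.ext (funext fun h => ?_)
    rw [GSubshift.smul_apply]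
    exact congrArg Q (mul_smul h g x).symm
  · refine Continuous.subtype_mk (continuous_pi fun g => ?_) _
    exact (continuous_of_discreteTopology (f := fun c => β (e.symm c))).comp
      ((continuous_apply g).comp continuous_subtype_val)
  · intro y
    obtain ⟨x, rfl⟩ := hπ.surjective y
    exact ⟨φ x, (congrFun hψφ x).symm⟩
  · intro g z
    rfl

end Intermediate

/-! ### Rarely visited sets -/

section Visits

variable {G : Type*} [Group G] {X : Type*} [MulAction G X]

/-- A set that each point enters under at most one element of `S` is visited with frequency at
most about `1 / |S|`. -/
lemma IsFolnerSeq.eventually_visits_le {F : ℕ → Finset G} (hF : IsFolnerSeq F) (V : Set X)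
    (S : Finset G) (hV : ∀ x, ∀ s ∈ S, ∀ t ∈ S, s • x ∈ V → t • x ∈ V → s = t)
    (hS : S.Nonempty) {δ : ℝ} (hδ : 1 / (S.card : ℝ) < δ) :
    ∀ᶠ n in atTop, ∀ x : X, (((F n).filter fun g => g • x ∈ V).card : ℝ) ≤ δ * (F n).card := by
  have hSpos : (0 : ℝ) < S.card := by exact_mod_cast hS.card_pos
  filter_upwards [hF.eventually_card_sdiff S⁻¹ (sub_pos.2 hδ)] with n hn x
  set N := ((F n).filter fun g => g • x ∈ V).card with hN
  set R := (S⁻¹ * F n) \ F n with hR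
  have h1 : ∀ s ∈ S, N ≤ ((F n).filter fun g => s • g • x ∈ V).card + R.card := by
    intro s hs
    have hsub : ((F n).filter fun g => g • x ∈ V) ⊆
        (((F n).filter fun g => s • g • x ∈ V) ∪ R).image (s * ·) := by
      intro g hg
      obtain ⟨hgF, hgV⟩ := Finset.mem_filter.1 hg
      refine Finset.mem_image.2 ⟨s⁻¹ * g, Finset.mem_union.2 ?_, mul_inv_cancel_left s g⟩
      by_cases h : s⁻¹ * g ∈ F n
      · exact Or.inl (Finset.mem_filter.2 ⟨h, by rwa [smul_smul, mul_inv_cancel_left]⟩)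
      · exact Or.inr (Finset.mem_sdiff.2
          ⟨Finset.mul_mem_mul (Finset.inv_mem_inv hs) hgF, h⟩)
    exact (Finset.card_le_card hsub).trans
      (Finset.card_image_le.trans (Finset.card_union_le _ _))
  -- Double counting: each `g • x` is sent into `V` by at most one `s ∈ S`. By `h1`, each of the
  -- `|S|` summands is nearly the number of visits.
  have h2 : ∑ s ∈ S, ((F n).filter fun g => s • g • x ∈ V).card ≤ (F n).card := by
    have : ∑ s ∈ S, ((F n).filter fun g => s • g • x ∈ V).card
        = ∑ g ∈ F n, (S.filter fun s => s • g • x ∈ V).card := by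
      simp only [Finset.card_filter]
      exact Finset.sum_comm
    rw [this, Finset.card_eq_sum_ones]
    refine Finset.sum_le_sum fun g _ => Finset.card_le_one.2 fun s hs t ht => ?_
    rw [Finset.mem_filter] at hs ht
    exact hV (g • x) s hs.1 t ht.1 hs.2 ht.2
  have h3 : S.card * N ≤ (F n).card + S.card * R.card := by
    calc S.card * N = ∑ s ∈ S, N := by simp
      _ ≤ ∑ s ∈ S, (((F n).filter fun g => s • g • x ∈ V).card + R.card) := Finset.sum_le_sum h1
      _ ≤ _ := by rw [Finset.sum_add_distrib]; simpa using h2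
  have h4 : (S.card : ℝ) * N ≤ (F n).card + S.card * R.card := by exact_mod_cast h3
  have h5 : (N : ℝ) ≤ 1 / S.card * (F n).card + R.card := by
    rw [← mul_le_mul_iff_right₀ hSpos]
    refine h4.trans_eq ?_
    field_simp
  linarith

/-! ### Counting sparse partial functions -/

/-- The number of partial functions with at most `d` values. -/
def partialCount (ι A : Type*) [Fintype ι] (d : ℕ) : ℕ :=
  {c : ι → Option A | (Finset.univ.filter fun i => c i ≠ none).card ≤ d}.ncard

/-- A Chernoff-type weighting: give each defined value weight `1 / t`. A function with at most `d`
values then has weight at least `t ^ (-d)`, and the total weight of all partial functions is a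
product over `ι`. -/
lemma partialCount_le (ι A : Type*) [Fintype ι] [Finite A] (d : ℕ) {t : ℝ} (ht : 1 ≤ t) :
    (partialCount ι A d : ℝ) ≤ t ^ d * (1 + Nat.card A / t) ^ Fintype.card ι := by
  have := Fintype.ofFinite A
  have ht0 : 0 < t := by linarith
  let w : Option A → ℝ := fun a => if a ≠ none then t⁻¹ else 1
  have hw0 : ∀ a, 0 < w a := fun a => by
    simp only [w]; split_ifs <;> positivity
  have hsum : ∑ a, w a = 1 + Nat.card A / t := by
    rw [Fintype.sum_option]
    simp [w, div_eq_mul_inv, Nat.card_eq_fintype_card]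
  have hprod : ∀ c : ι → Option A, ∏ i, w (c i)
      = (t⁻¹) ^ (Finset.univ.filter fun i => c i ≠ none).card := by
    intro c
    simp only [w]
    rw [Finset.prod_ite]
    simp
  rw [partialCount, Set.ncard_eq_toFinset_card', Finset.card_eq_sum_ones]
  push_cast
  rw [← hsum, ← Finset.card_univ (α := ι), ← Finset.prod_const, Finset.prod_univ_sum,
    Fintype.piFinset_univ, Finset.mul_sum]
  refine le_trans (b := ∑ c ∈ {c : ι → Option A |
    (Finset.univ.filter fun i => c i ≠ none).card ≤ d}.toFinset, t ^ d * ∏ i, w (c i)) ?_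
    (Finset.sum_le_sum_of_subset_of_nonneg (Finset.subset_univ _) fun c _ _ => mul_nonneg (by positivity) (Finset.prod_nonneg fun i _ => (hw0 _).le))
  refine Finset.sum_le_sum fun c hc => ?_
  have hc' : (Finset.univ.filter fun i => c i ≠ none).card ≤ d := by simpa using hc
  rw [hprod, inv_pow, ← div_eq_mul_inv, one_le_div (by positivity)]
  exact pow_le_pow_right₀ ht hc'

lemma exists_log_partialCount_le (G A : Type*) [Finite A] {ε : ℝ} (hε : 0 < ε) :
    ∃ δ : ℝ, 0 < δ ∧ ∀ (E : Finset G) (d : ℕ), (d : ℝ) ≤ δ * E.card →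
      Real.log (partialCount E A d) ≤ ε * E.card := by
  -- First `t` is taken so large that `log (1 + |A| / t) ≤ ε / 2`; then `δ` so small that `δ log t =
  -- ε / 2`.
  set t : ℝ := 2 * (Nat.card A + 1) / ε + 1 with ht
  have ht1 : 1 < t := by
    have : 0 < 2 * ((Nat.card A : ℝ) + 1) / ε := by positivity
    linarith
  have hlog : 0 < Real.log t := Real.log_pos ht1
  have hA : (Nat.card A : ℝ) / t ≤ ε / 2 := by
    rw [div_le_iff₀ (by linarith), ht]
    have : ε / 2 * (2 * ((Nat.card A : ℝ) + 1) / ε + 1) = Nat.card A + 1 + ε / 2 := by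
      field_simp
    linarith
  refine ⟨ε / (2 * Real.log t), by positivity, fun E d hd => ?_⟩
  have hle := partialCount_le E A d ht1.le
  rw [Fintype.card_coe] at hle
  have hlog1 : Real.log (1 + Nat.card A / t) ≤ ε / 2 := by
    have : 0 < 1 + (Nat.card A : ℝ) / t := by positivity
    linarith [Real.log_le_sub_one_of_pos this]
  rcases Nat.eq_zero_or_pos (partialCount E A d) with h0 | h0
  · rw [h0]; simp; positivity
  calc Real.log (partialCount E A d)
      ≤ Real.log (t ^ d * (1 + Nat.card A / t) ^ E.card) :=
        Real.log_le_log (by exact_mod_cast h0) hle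
    _ = d * Real.log t + E.card * Real.log (1 + Nat.card A / t) := by
        rw [Real.log_mul (by positivity) (by positivity), Real.log_pow, Real.log_pow]
    _ ≤ ε / (2 * Real.log t) * E.card * Real.log t + E.card * (ε / 2) := by
        gcongr
    _ = ε * E.card := by field_simp; ring

/-! ### Partially revealed observables -/

/-- The observable `q` together with `f` on the set `W`. -/
def reveal {A B : Type*} (q : X → B) (f : X → A) (W : Set X) (x : X) : B × Option A :=
  (q x, if x ∈ W then some (f x) else none)

lemma continuous_reveal [TopologicalSpace X] {A B : Type*} [TopologicalSpace A]
    [DiscreteTopology A] [TopologicalSpace B] [TopologicalSpace (Option A)] {q : X → B} {f : X → A}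
    (hq : Continuous q) (hf : Continuous f) {W : Set X} (hW : IsClopen W) :
    Continuous (reveal q f W) := by
  refine hq.prodMk (continuous_if (fun x hx => ?_) ?_ continuousOn_const)
  · rw [show {x | x ∈ W} = W from rfl, hW.frontier_eq] at hx
    exact absurd hx (Set.notMem_empty x)
  · exact ((continuous_of_discreteTopology (f := (some : A → Option A))).comp hf).continuousOn

/-- Revealing `f` on a further set costs at most the number of its possible traces. -/
lemma nameCount_reveal_union_le {A B : Type*} [Finite A] [Finite B] (q : X → B) (f : X → A)
    (W V : Set X) (E : Finset G) (d : ℕ) (hd : ∀ x : X, (E.filter fun g => g • x ∈ V).card ≤ d) :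
    nameCount (reveal q f (W ∪ V)) E ≤ nameCount (reveal q f W) E * partialCount E A d := by
  have := Fintype.ofFinite A
  refine ncard_range_le_mul _ _ _ fun x₀ => ?_
  let Ψ : (E → Option A) → (E → B × Option A) := fun c g =>
    (q ((g : G) • x₀), (c g).or (reveal q f W ((g : G) • x₀)).2)
  refine le_trans (Set.ncard_le_ncard ?_) (Set.ncard_image_le (f := Ψ))
  rintro _ ⟨x, hx, rfl⟩
  have hx' := nameOn_eq_iff.1 hx
  refine ⟨fun g => if (g : G) • x ∈ V then some (f ((g : G) • x)) else none, ?_, ?_⟩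
  · refine le_trans (Finset.card_le_card_of_injOn Subtype.val ?_
      Subtype.val_injective.injOn) (hd x)
    intro g hg
    simp only [ne_eq, Finset.coe_filter, Finset.mem_univ, true_and, Set.mem_ofPred_eq] at hg ⊢
    exact ⟨g.2, by by_contra h; simp [h] at hg⟩
  · funext g
    have h := hx' g g.2
    have h1 : q ((g : G) • x) = q ((g : G) • x₀) := congrArg Prod.fst h
    have h2 : (reveal q f W ((g : G) • x)).2 = (reveal q f W ((g : G) • x₀)).2 :=
      congrArg Prod.snd h
    simp only [Ψ, nameOn]
    rw [← h1, ← h2]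
    by_cases hV : (g : G) • x ∈ V <;> simp [reveal, hV]

/-- Revealing `f` on a rarely visited set costs little entropy. -/
lemma nameEntropy_reveal_union_le {F : ℕ → Finset G} (hF : IsFolnerSeq F) {A B : Type*} [Finite A]
    [Finite B] (q : X → B) (f : X → A) {ε δ : ℝ}
    (hδ : ∀ (E : Finset G) (d : ℕ), (d : ℝ) ≤ δ * E.card →
      Real.log (partialCount E A d) ≤ ε * E.card) (hδ0 : 0 < δ)
    (W V : Set X) (hV : ∀ᶠ n in atTop, ∀ x : X,
      (((F n).filter fun g => g • x ∈ V).card : ℝ) ≤ δ * (F n).card) :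
    nameEntropy F (reveal q f (W ∪ V)) ≤ nameEntropy F (reveal q f W) + ε := by
  refine nameEntropy_le_add hF _ _ ε (fun n => partialCount (F n) A ⌊δ * (F n).card⌋₊) ?_
  filter_upwards [hV] with n hn
  constructor
  · exact nameCount_reveal_union_le q f W V (F n) _ fun x => Nat.le_floor (hn x)
  · refine hδ (F n) _ ?_
    exact Nat.floor_le (by positivity)

/-- A point with more than `m` points in its orbit has a clopen neighbourhood that each point
enters under at most one of `m + 1` group elements. -/
lemma exists_isClopen_of_notMem_smallOrbits [TopologicalSpace X] [CompactSpace X] [T2Space X]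
    [TotallyDisconnectedSpace X] [ContinuousConstSMul G X] {m : ℕ} {x : X}
    (hx : x ∉ smallOrbits G X m) :
    ∃ (V : Set X) (S : Finset G), IsClopen V ∧ x ∈ V ∧ S.card = m + 1 ∧
      ∀ z, ∀ s ∈ S, ∀ t ∈ S, s • z ∈ V → t • z ∈ V → s = t := by
  have hx' : ((m + 1 : ℕ) : ℕ∞) ≤ (MulAction.orbit G x).encard := by
    push_cast
    exact Order.add_one_le_of_lt (not_le.1 hx)
  obtain ⟨T, hT, hTc⟩ := Set.exists_subset_encard_eq hx'
  have hTfin : T.Finite := Set.finite_of_encard_eq_coe hTc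
  have hc : ∀ y : X, ∃ g : G, y ∈ T → g • x = y := by
    intro y
    by_cases hy : y ∈ T
    · obtain ⟨g, hg⟩ := hT hy
      exact ⟨g, fun _ => hg⟩
    · exact ⟨1, fun h => absurd h hy⟩
  choose c hc using hc
  -- Since `c y • x = y`, the inverses satisfy `((c y)⁻¹ * c z) • x = x` only for `y = z`; so `s *
  -- t⁻¹` moves `x` for distinct `s, t ∈ S`, and a small neighbourhood off itself.
  set S : Finset G := hTfin.toFinset.image fun y => (c y)⁻¹ with hS
  have hSc : S.card = m + 1 := by
    rw [hS, Finset.card_image_of_injOn, ← Set.ncard_eq_toFinset_card _ hTfin, Set.ncard, hTc]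
    · rfl
    · intro y hy z hz h
      have hy' : y ∈ T := by simpa using hy
      have hz' : z ∈ T := by simpa using hz
      rw [← hc y hy', ← hc z hz', inv_injective h]
  have hSx : ∀ s ∈ S, ∀ t ∈ S, s ≠ t → (s * t⁻¹) • x ≠ x := by
    intro s hs t ht hst h
    obtain ⟨y, hy, rfl⟩ := Finset.mem_image.1 hs
    obtain ⟨z, hz, rfl⟩ := Finset.mem_image.1 ht
    have hy' : y ∈ T := by simpa using hy
    have hz' : z ∈ T := by simpa using hz
    rw [inv_inv, mul_smul, inv_smul_eq_iff, hc y hy', hc z hz'] at h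
    exact hst (by rw [h])
  have hU : ∀ p : G × G, ∃ U : Set X, IsOpen U ∧ x ∈ U ∧ (p ∈ S ×ˢ S → p.1 ≠ p.2 →
      ∀ w ∈ U, (p.1 * p.2⁻¹) • w ∉ U) := by
    rintro ⟨s, t⟩
    by_cases h : (s * t⁻¹) • x = x
    · refine ⟨Set.univ, isOpen_univ, trivial, fun hp hne => ?_⟩
      rw [Finset.mem_product] at hp
      exact absurd h (hSx s hp.1 t hp.2 hne)
    · obtain ⟨u, v, hu, hv, hxu, hxv, huv⟩ := t2_separation h
      refine ⟨v ∩ (fun w => (s * t⁻¹) • w) ⁻¹' u,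
        hv.inter (hu.preimage (continuous_const_smul _)), ⟨hxv, hxu⟩, fun _ _ w hw hw' => ?_⟩
      exact Set.disjoint_left.1 huv hw.2 hw'.1
  choose U hUo hxU hUd using hU
  obtain ⟨V, hV, hxV, hVU⟩ := compact_exists_isClopen_in_isOpen
    (isOpen_biInter_finset (s := S ×ˢ S) fun p _ => hUo p)
    (Set.mem_iInter₂.2 fun p _ => hxU p)
  refine ⟨V, S, hV, hxV, hSc, fun z s hs t ht hsz htz => ?_⟩
  by_contra hne
  have hp : (s, t) ∈ S ×ˢ S := Finset.mk_mem_product hs ht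
  refine hUd (s, t) hp hne (t • z) (Set.mem_iInter₂.1 (hVU htz) _ hp) ?_
  rw [smul_smul, inv_mul_cancel_right]
  exact Set.mem_iInter₂.1 (hVU hsz) _ hp

/-! ### Shadows -/

/-- The points that look like a point of `B` at the identity and along `E`. -/
def shadow {A : Type*} (f : X → A) (B : Set X) (E : Finset G) : Set X :=
  {x | ∃ b ∈ B, f x = f b ∧ ∀ h ∈ E, f (h • x) = f (h • b)}

lemma subset_shadow {A : Type*} (f : X → A) (B : Set X) (E : Finset G) : B ⊆ shadow f B E :=
  fun b hb => ⟨b, hb, rfl, fun _ _ => rfl⟩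

/-- Membership depends only on the finitely many symbols at the identity and along `E`, so no
topological condition on `B` is needed. -/
lemma isClopen_shadow [TopologicalSpace X] [ContinuousConstSMul G X] {A : Type*}
    [TopologicalSpace A] [DiscreteTopology A] {f : X → A} (hf : Continuous f) (B : Set X)
    (E : Finset G) : IsClopen (shadow f B E) := by
  let Φ : X → A × (E → A) := fun x => (f x, nameOn f E x)
  have hΦ : Continuous Φ :=
    hf.prodMk (continuous_pi fun g => hf.comp (continuous_const_smul _))
  have : shadow f B E = Φ ⁻¹' (Φ '' B) := by
    ext x
    constructor
    · rintro ⟨b, hb, h1, h2⟩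
      exact ⟨b, hb, Prod.ext h1.symm (nameOn_eq_iff.2 h2).symm⟩
    · rintro ⟨b, hb, h⟩
      exact ⟨b, hb, (congrArg Prod.fst h).symm, nameOn_eq_iff.1 (congrArg Prod.snd h).symm⟩
  rw [this]
  exact (isClopen_discrete _).preimage hΦ

/-- Once `f` is revealed off the shadow of the points with small orbits, hardly any entropy is
left. -/
lemma nameEntropy_le_nameEntropy_reveal_add {F : ℕ → Finset G} (hF : IsFolnerSeq F)
    {A B : Type*} [Finite A] [Finite B] (q : X → B) (f : X → A) (P : Set X) (E : Finset G)
    (D N : ℕ) {ε : ℝ} (hε : 0 < ε) (hD : 0 < D) (hN : 1 ≤ N) (hND : Real.log N ≤ ε * D)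
    (hPN : (nameOn f E '' P).ncard ≤ N)
    (hPD : ∀ x ∈ P, ∀ y ∈ P, f x ≠ f y → D ≤ (E.filter fun h => f (h • x) ≠ f (h • y)).card)
    (W : Set X) (hW : (shadow f P E)ᶜ ⊆ W) :
    nameEntropy F f ≤ nameEntropy F (reveal q f W) + (2 * ε : ℝ) := by
  refine nameEntropy_le_add hF _ _ _ (fun n => N ^ ((E * F n).card / D)) ?_
  filter_upwards [hF.eventually_card_sdiff E one_pos] with n hn
  constructor
  · refine ncard_range_le_mul _ _ _ fun x₀ => ?_
    have hfib : ∀ x, nameOn (reveal q f W) (F n) x = nameOn (reveal q f W) (F n) x₀ →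
        ∀ g ∈ F n, (g • x ∈ W ↔ g • x₀ ∈ W) ∧ (g • x₀ ∈ W → f (g • x) = f (g • x₀)) := by
      intro x hx g hg
      have h : (reveal q f W (g • x)).2 = (reveal q f W (g • x₀)).2 :=
        congrArg Prod.snd (nameOn_eq_iff.1 hx g hg)
      by_cases h1 : g • x ∈ W <;> by_cases h2 : g • x₀ ∈ W <;> simp_all [reveal]
    -- The revealed name shows which sites lie in `W`, so the hidden sites are the same for the
    -- whole fibre. At those sites the point is in the shadow. The greedy count starts with no known
    -- sites.
    refine ncard_nameOn_le_pow f P E D N hN hPN hPD (F n) ((F n).filter fun g => g • x₀ ∉ W)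
      (Finset.filter_subset _ _) _ ∅ _ ?_ (by simp) ?_ ?_
    · rw [Finset.sdiff_empty]
      exact Nat.lt_mul_of_div_lt (Nat.lt_succ_self _) hD
    · intro x hx y hy g hg
      have hg' : g ∈ F n ∧ g • x₀ ∈ W := by
        simp only [Finset.mem_sdiff, Finset.mem_filter, not_and, not_not] at hg
        exact ⟨hg.1, hg.2 hg.1⟩
      rw [(hfib x hx g hg'.1).2 hg'.2, (hfib y hy g hg'.1).2 hg'.2]
    · intro x hx g hg
      obtain ⟨hgF, hgW⟩ := Finset.mem_filter.1 hg
      have : g • x ∉ W := fun h => hgW ((hfib x hx g hgF).1.1 h)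
      by_contra hcon
      exact this (hW hcon)
  · have hcard : ((E * F n).card : ℝ) ≤ 2 * (F n).card := by
      have h1 : (E * F n).card ≤ ((E * F n) \ F n).card + (F n).card := 
        Finset.card_le_card_sdiff_add_card
      have h2 : ((E * F n).card : ℝ) ≤ ((E * F n) \ F n).card + (F n).card := by exact_mod_cast h1
      linarith
    have hlogN : 0 ≤ Real.log N := Real.log_natCast_nonneg N
    push_cast
    rw [Real.log_pow]
    have hdiv : (((E * F n).card / D : ℕ) : ℝ) * D ≤ (E * F n).card := by
      exact_mod_cast Nat.div_mul_le_self _ _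
    calc (((E * F n).card / D : ℕ) : ℝ) * Real.log N
        ≤ (((E * F n).card / D : ℕ) : ℝ) * (ε * D) := by gcongr
      _ = ε * ((((E * F n).card / D : ℕ) : ℝ) * D) := by ring
      _ ≤ ε * (2 * (F n).card) := mul_le_mul_of_nonneg_left (hdiv.trans hcard) hε.le
      _ = 2 * ε * (F n).card := by ring

end Visits

/-! ### Density of intermediate entropies -/

/-- A sequence with steps at most `ε` that starts below `t` and comes within `ε` of `t` from below
or passes it has a term within `ε` of `t`. -/
lemma exists_abs_sub_le_of_small_steps {a : ℕ → ℝ} {t ε : ℝ} (h0 : a 0 ≤ t)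
    (hstep : ∀ k, a (k + 1) ≤ a k + ε) (K : ℕ) (hK : t ≤ a K + ε) :
    ∃ k, |a k - t| ≤ ε := by
  have hex : ∃ k, t ≤ a k + ε := ⟨K, hK⟩
  -- At the first such index the preceding term plus `ε` is still below `t`, so one step cannot pass
  -- `t`.
  refine ⟨Nat.find hex, abs_le.2 ⟨by linarith [Nat.find_spec hex], ?_⟩⟩
  rcases Nat.eq_zero_or_pos (Nat.find hex) with hz | hpos
  · have := Nat.find_spec hex
    rw [hz] at this ⊢
    linarith
  · have hmin := Nat.find_min hex (Nat.sub_lt hpos one_pos)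
    have hs := hstep (Nat.find hex - 1)
    rw [Nat.sub_add_cancel hpos] at hs
    have := Nat.find_spec hex
    push Not at hmin
    linarith

section Chain

variable {G : Type*} [Group G] [Infinite G] {X : Type*} [MulAction G X] [TopologicalSpace X]
  [CompactSpace X] [T2Space X] [TotallyDisconnectedSpace X] [ContinuousConstSMul G X]

/-- There is a finite increasing chain of clopen sets along which revealing `f` costs little
entropy at each step, and which ends with almost all of the entropy of `f`. -/
lemma exists_clopen_chain {F : ℕ → Finset G} (hF : IsFolnerSeq F) {A B : Type*} [Finite A]
    [TopologicalSpace A] [DiscreteTopology A] [Finite B] (q : X → B) {f : X → A}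
    (hf : Continuous f) {ε : ℝ} (hε : 0 < ε) :
    ∃ (W : ℕ → Set X) (K : ℕ), (∀ k, IsClopen (W k)) ∧ W 0 = ∅ ∧
      (∀ k, nameEntropy F (reveal q f (W (k + 1))) ≤ nameEntropy F (reveal q f (W k)) + ε) ∧
      nameEntropy F f ≤ nameEntropy F (reveal q f (W K)) + ε := by
  obtain ⟨δ, hδ0, hδ⟩ := exists_log_partialCount_le G A hε
  obtain ⟨m₀, hm₀⟩ := exists_nat_one_div_lt hδ0
  -- The shift by one ensures `1 ≤ m`, as `exists_predicting_set` requires; the separating sets have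
  -- `m + 1` elements.
  set m := m₀ + 1 with hm
  have hmδ : 1 / ((m + 1 : ℕ) : ℝ) < δ := by
    refine lt_of_le_of_lt ?_ hm₀
    rw [hm]
    push_cast
    exact one_div_le_one_div_of_le (by positivity) (by linarith)
  obtain ⟨E, D, N, hD, hN, hND, hcount, hfar⟩ :=
    exists_predicting_set (G := G) f m (by omega) (half_pos hε)
  set P := smallOrbits G X m
  have hclopen : IsClopen (shadow f P E) := isClopen_shadow hf P E
  have hnbhd : ∀ x : X, ∃ V : Set X, IsClopen V ∧ (x ∈ (shadow f P E)ᶜ → x ∈ V) ∧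
      ∀ᶠ n in atTop, ∀ z : X, (((F n).filter fun g => g • z ∈ V).card : ℝ) ≤ δ * (F n).card := by
    intro x
    by_cases hx : x ∈ shadow f P E
    · exact ⟨∅, isClopen_empty, fun h => absurd hx h,
        Eventually.of_forall fun n z => by simp; positivity⟩
    · obtain ⟨V, S, hV, hxV, hS, hsep⟩ := exists_isClopen_of_notMem_smallOrbits (G := G)
        fun h => hx (subset_shadow f P E h)
      exact ⟨V, hV, fun _ => hxV, hF.eventually_visits_le V S hsep
        (Finset.card_pos.1 (by omega)) (by rwa [hS])⟩
  choose V hVc hVx hVd using hnbhd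
  obtain ⟨T, hT⟩ := hclopen.compl.isClosed.isCompact.elim_finite_subcover V
    (fun x => (hVc x).isOpen) fun x hx => Set.mem_iUnion.2 ⟨x, hVx x hx⟩
  -- Padding with `∅` makes the step bound hold for every `k`, not only below `T.card`.
  let V' : ℕ → Set X := fun i => if h : i < T.card then V (T.equivFin.symm ⟨i, h⟩) else ∅
  have hV'c : ∀ i, IsClopen (V' i) := fun i => by
    simp only [V']; split_ifs
    · exact hVc _
    · exact isClopen_empty
  have hV'd : ∀ i, ∀ᶠ n in atTop, ∀ z : X,
      (((F n).filter fun g => g • z ∈ V' i).card : ℝ) ≤ δ * (F n).card := fun i => by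
    simp only [V']; split_ifs
    · exact hVd _
    · exact Eventually.of_forall fun n z => by simp; positivity
  refine ⟨fun k => ⋃ i < k, V' i, T.card, fun k => ?_, by simp, fun k => ?_, ?_⟩
  · exact (Set.finite_lt_nat k).isClopen_biUnion fun i _ => hV'c i
  · simp only [Set.biUnion_lt_succ]
    exact nameEntropy_reveal_union_le hF q f hδ hδ0 _ _ (hV'd k)
  · have := nameEntropy_le_nameEntropy_reveal_add hF q f P E D N (half_pos hε) hD hN hND hcount
      hfar (⋃ i < T.card, V' i) ?_
    · rwa [mul_div_cancel₀ _ two_ne_zero] at this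
    · refine hT.trans (Set.iUnion₂_subset fun x hx y hy => ?_)
      refine Set.mem_iUnion₂.2 ⟨T.equivFin ⟨x, hx⟩, (T.equivFin ⟨x, hx⟩).2, ?_⟩
      simpa [V'] using hy

end Chain

end

theorem theorem1p2 {G : Type*} [Group G] [Countable G] [Infinite G]
    (F : ℕ → Finset G) (hF : IsFolnerSeq F)
    {A B : Type*} [Finite A] [TopologicalSpace A] [DiscreteTopology A]
    [Finite B] [TopologicalSpace B] [DiscreteTopology B]
    (X : GSubshift G A) (Y : GSubshift G B) (π : X → Y) (hπ : IsFactorMap G π) :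
    ∃ a b : ℝ, topEntropy F Y = (a : EReal) ∧ topEntropy F X = (b : EReal) ∧
      intermediateSubshiftEntropies F X Y π ⊆ Set.Icc a b ∧
      Set.Icc a b ⊆ closure (intermediateSubshiftEntropies F X Y π) := by
  obtain ⟨a, ha⟩ := exists_nameEntropy_eq_coe hF Y.symbol
  obtain ⟨b, hb⟩ := exists_nameEntropy_eq_coe hF X.symbol
  have ha' : topEntropy F Y = a := (GSubshift.topEntropy_eq hF Y).trans ha
  have hb' : topEntropy F X = b := (GSubshift.topEntropy_eq hF X).trans hb
  refine ⟨a, b, ha', hb', ?_, ?_⟩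
  · rintro r ⟨C, _, _, _, Z, φ, ψ, hr, hφ, hψ, -⟩
    constructor
    · rw [← EReal.coe_le_coe_iff, ← ha', ← hr]
      exact hψ.topEntropy_le F
    · rw [← EReal.coe_le_coe_iff, ← hb', ← hr]
      exact hφ.topEntropy_le F
  · intro t ht
    refine Metric.mem_closure_iff.2 fun ε hε => ?_
    let q : X → B := fun x => Y.symbol (π x)
    have hq : Continuous q := Y.continuous_symbol.comp hπ.continuous
    obtain ⟨W, K, hW, hW0, hstep, hlast⟩ :=
      exists_clopen_chain hF q X.continuous_symbol (half_pos hε)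
    choose c hc using fun k => exists_nameEntropy_eq_coe hF (reveal q X.symbol (W k))
    have hmem : ∀ k, c k ∈ intermediateSubshiftEntropies F X Y π := by
      intro k
      let _ : TopologicalSpace (Option A) := ⊥
      have : DiscreteTopology (Option A) := ⟨rfl⟩
      exact exists_intermediate hF hπ (reveal q X.symbol (W k))
        (continuous_reveal hq X.continuous_symbol (hW k)) Prod.fst (fun _ => rfl) (hc k)
    -- With nothing revealed, the second coordinate is constantly `none`, so names are determined by
    -- `q`, and `q`-names are patterns of `Y`.
    have h0 : c 0 ≤ t := by
      refine le_trans ?_ ht.1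
      rw [← EReal.coe_le_coe_iff, ← hc, ← ha]
      refine nameEntropy_mono F _ _ fun n => ?_
      have h1 : nameCount (reveal q X.symbol (W 0)) (F n) ≤ nameCount q (F n) := by
        refine ncard_range_le_of_determines _ _ fun x y h => nameOn_eq_iff.2 fun g hg => ?_
        simp only [reveal, hW0, Set.mem_empty_iff_false, if_false]
        rw [nameOn_eq_iff.1 h g hg]
      refine h1.trans (Set.ncard_le_ncard ?_)
      rintro _ ⟨x, rfl⟩
      exact ⟨π x, funext fun g => by simp [nameOn, q, hπ.map_smul]⟩
    have hstep' : ∀ k, c (k + 1) ≤ c k + ε / 2 := by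
      intro k
      have := hstep k
      rw [hc, hc] at this
      exact_mod_cast this
    have hlast' : t ≤ c K + ε / 2 := by
      refine ht.2.trans ?_
      rw [hb, hc] at hlast
      exact_mod_cast hlast
    obtain ⟨k, hk⟩ := exists_abs_sub_le_of_small_steps h0 hstep' K hlast'
    refine ⟨c k, hmem k, ?_⟩
    rw [dist_comm, Real.dist_eq]
    linarith
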